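/- **Setting.** For a square matrix $A$ with non-negative integer entries, indexed by a finite set $I$, let $\Gamma_A$ be the directed graph with vertex set $I$ (the *states*) and $A(i,j)$ parallel edges from $i$ to $j$. The *shift of finite type* $X_A$ is the set of bi-infinite sequences $(x_n)_{n\in\mathbb Z}$ of edges in which the terminal vertex of $x_n$ is the initial vertex of $x_{n+1}$ for every $n$, with the topology induced by the product of discrete topologies and the shift homeomorphism $(\sigma x)_n=x_{n+1}$. A *topological conjugacy* $X_A\to X_B$ is a homeomorphism commuting with $\sigma$; $\mathrm{Aut}(X_A)$ is the group of topological conjugacies of $X_A$ with itself. Let $G$ be a finite group. A *permutation action* $(X_A,\varphi)$ of $G$ consists of a matrix $A$ with entries in $\{0,1\}$ such that every state has a follower and a predecessor (no row and no column of $A$ is zero), and a homomorphism $\varphi: G\to\mathrm{Aut}(X_A)$ such that each $\varphi(g)$ is induced by a permutation $i\mapsto gi$ of the states: if $x\in X_A$ has the sequence of initial vertices $(v_n)$, then $\varphi(g)x$ has the sequence of initial vertices $(gv_n)$. These permutations form an action of $G$ on $I$ with $A(gi,gj)=A(i,j)$; write $Gi$ for the orbit of $i$. Permutation actions $(X_A,\varphi)$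 and $(X_B,\psi)$ of $G$ are *conjugate* if there is a topological conjugacy $\eta:X_A\to X_B$ with $\eta\circ\varphi(g)=\psi(g)\circ\eta$ for all $g\in G$. The *right-reduced shift* $X_\varphi$ and the *left-reduced shift* ${}_\varphi X$ of $(X_A,\varphi)$ are the shifts of finite type of the matrices $A_\varphi$ and ${}_\varphi A$, both indexed by the $G$-orbits of states, with $$A_\varphi(Gi,Gj)=\sum_{k\in Gj}A(i,k),\qquad {}_\varphi A(Gi,Gj)=\sum_{k\in Gi}A(k,j).$$ **Theorem.** Let $(X_A,\varphi)$ and $(X_B,\psi)$ be conjugate permutation actions of a finite group $G$. Then the right-reduced shifts $X_\varphi$ and $X_\psi$ are topologically conjugate, and the left-reduced shifts ${}_\varphi X$ and ${}_\psi X$ are topologically conjugate. -/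

import Mathlib

open SymbolicDynamics

universe u v

namespace ReducedShift

/-! ### The shift of finite type of a non-negative integer matrix -/

/-- The edges of the finite directed graph with adjacency matrix `A`: there are `A i j` parallel
edges from the vertex (state) `i` to the vertex `j`. -/
structure Edge {I : Type u} (A : Matrix I I ℕ) where
  /-- The initial vertex. -/
  src : I
  /-- The terminal vertex. -/
  tgt : I
  /-- The label among the parallel edges from `src` to `tgt`. -/
  idx : Fin (A src tgt)

/-- The alphabet of edges carries the discrete topology. -/
instance {I : Type u} (A : Matrix I I ℕ) : TopologicalSpace (Edge A) := ⊥

instance {I : Type u} (A : Matrix I I ℕ) : DiscreteTopology (Edge A) := ⟨rfl⟩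

/-- The alphabet is finite when the set of states is. -/
instance {I : Type u} [Finite I] (A : Matrix I I ℕ) : Finite (Edge A) := by
  have (i : I) : Finite (Σ j : I, Fin (A i j)) :=
    inferInstanceAs (Finite (Sigma fun j : I => Fin (A i j)))
  refine Finite.of_injective
    (β := Σ i : I, Σ j : I, Fin (A i j)) (fun e => ⟨e.src, e.tgt, e.idx⟩) ?_
  rintro ⟨i, j, a⟩ ⟨i', j', a'⟩ h
  simp only [Sigma.mk.injEq] at h
  obtain ⟨rfl, h⟩ := h
  simp only [heq_eq_eq, Sigma.mk.injEq] at h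
  obtain ⟨rfl, h⟩ := h
  simp only [heq_eq_eq] at h
  rw [h]

/-- The shift of finite type `X_A`: the subshift of the bi-infinite sequences of edges that
correspond to paths in the graph with adjacency matrix `A`. -/
def sft {I : Type u} (A : Matrix I I ℕ) : FullShift.Subshift (Edge A) ℤ where
  carrier := {x | ∀ n : ℤ, (x n).tgt = (x (n + 1)).src}
  isClosed := by
    have h : {x : ℤ → Edge A | ∀ n : ℤ, (x n).tgt = (x (n + 1)).src} =
        ⋂ n : ℤ, (fun x : ℤ → Edge A => (x n, x (n + 1))) ⁻¹'
          {p : Edge A × Edge A | p.1.tgt = p.2.src} := by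
      ext x
      simp
    rw [h]
    exact isClosed_iInter fun n => (isClosed_discrete _).preimage (by fun_prop)
  mapsTo := by
    intro g x hx n
    have h := hx (g + n)
    rw [add_assoc] at h
    exact h

/-- The points of `X_A`, with the subspace topology of the product topology. -/
abbrev SFT {I : Type u} (A : Matrix I I ℕ) : Type u := (sft A).carrier

/-- The left shift homeomorphism `σ` of `X_A`, `(σ x)ₙ = xₙ₊₁`. -/
def shiftHomeo {I : Type u} (A : Matrix I I ℕ) : SFT A ≃ₜ SFT A where
  toFun x := ⟨FullShift.shift (1 : ℤ) x.1, (sft A).mapsTo 1 x.2⟩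
  invFun x := ⟨FullShift.shift (-1 : ℤ) x.1, (sft A).mapsTo (-1) x.2⟩
  left_inv x := by
    ext1
    funext n
    simp [FullShift.shift]
  right_inv x := by
    ext1
    funext n
    simp [FullShift.shift]
  continuous_toFun := by
    refine Continuous.subtype_mk ?_ _
    exact (FullShift.continuous_shift (1 : ℤ)).comp continuous_subtype_val
  continuous_invFun := by
    refine Continuous.subtype_mk ?_ _
    exact (FullShift.continuous_shift (-1 : ℤ)).comp continuous_subtype_val

theorem shiftHomeo_apply {I : Type u} (A : Matrix I I ℕ) (x : SFT A) (n : ℤ) :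
    (shiftHomeo A x).1 n = x.1 (n + 1) := by
  simp [shiftHomeo, FullShift.shift, add_comm]

/-- `X_A` and `X_B` are topologically conjugate: there is a homeomorphism commuting with the
shifts. -/
def Conjugate {I : Type u} {J : Type v} (A : Matrix I I ℕ) (B : Matrix J J ℕ) : Prop :=
  ∃ η : SFT A ≃ₜ SFT B, ∀ x, η (shiftHomeo A x) = shiftHomeo B (η x)

/-- The automorphism group of `(X_A, σ)`: the self-homeomorphisms commuting with `σ`. -/
abbrev Aut {I : Type u} (A : Matrix I I ℕ) : Subgroup (SFT A ≃ₜ SFT A) :=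
  Subgroup.centralizer {shiftHomeo A}

/-- Two `G`-actions `(X_A, φ)` and `(X_B, ψ)`, that is, homomorphisms of `G` to the automorphism
groups, are conjugate: some topological conjugacy `η` satisfies `η ∘ φ g = ψ g ∘ η` for all `g`. -/
def ActionConjugate {G : Type*} [Group G] {I : Type u} {J : Type v}
    {A : Matrix I I ℕ} {B : Matrix J J ℕ} (φ : G →* Aut A) (ψ : G →* Aut B) : Prop :=
  ∃ η : SFT A ≃ₜ SFT B, (∀ x, η (shiftHomeo A x) = shiftHomeo B (η x)) ∧
    ∀ (g : G) (x : SFT A), η ((φ g).1 x) = (ψ g).1 (η x)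

/-! ### Permutation actions -/

/-- A permutation action of `G` on `X_A`. The matrix `A` has entries in `{0, 1}`, every state has
a follower and a predecessor, and every `φ g` is induced by a permutation of the states: if `x`
visits the states `vₙ`, then `φ g x` visits the states `perm g vₙ`. Since every state is visited by
some point of `X_A`, the permutations are determined by `φ` and depend on `g` homomorphically. -/
structure PermutationAction (G : Type*) [Group G] {I : Type u} (A : Matrix I I ℕ) where
  zero_one : ∀ i j, A i j = 0 ∨ A i j = 1
  exists_follower : ∀ i, ∃ j, A i j ≠ 0
  exists_predecessor : ∀ j, ∃ i, A i j ≠ 0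
  /-- The action of `G` on `X_A`. -/
  φ : G →* Aut A
  /-- The permutation of the states that induces `φ g`. -/
  perm : G →* Equiv.Perm I
  induced : ∀ (g : G) (x : SFT A) (n : ℤ), (((φ g).1 x).1 n).src = perm g (x.1 n).src

/-- If all states have followers and predecessors, every edge lies on a bi-infinite path. -/
theorem exists_point {I : Type u} {A : Matrix I I ℕ}
    (hf : ∀ i, ∃ j, A i j ≠ 0) (hp : ∀ j, ∃ i, A i j ≠ 0) {i j : I} (hij : A i j ≠ 0) :
    ∃ x : SFT A, (x.1 0).src = i ∧ (x.1 1).src = j := by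
  choose f hf using hf
  choose p hp using hp
  let v : ℤ → I := fun n => match n with
    | Int.ofNat 0 => i
    | Int.ofNat (k + 1) => f^[k] j
    | Int.negSucc k => p^[k + 1] i
  have hv : ∀ n : ℤ, A (v n) (v (n + 1)) ≠ 0 := by
    intro n
    match n with
    | Int.ofNat 0 => exact hij
    | Int.ofNat (k + 1) =>
      change A (f^[k] j) (f^[k + 1] j) ≠ 0
      rw [Function.iterate_succ_apply']
      exact hf _
    | Int.negSucc 0 => exact hp i
    | Int.negSucc (k + 1) =>
      have h : Int.negSucc (k + 1) + 1 = Int.negSucc k := by omega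
      rw [h]
      change A (p^[k + 2] i) (p^[k + 1] i) ≠ 0
      rw [Function.iterate_succ_apply' p (k + 1)]
      exact hp _
  refine ⟨⟨fun n => ⟨v n, v (n + 1), ⟨0, Nat.pos_of_ne_zero (hv n)⟩⟩, fun n => rfl⟩, rfl, rfl⟩

namespace PermutationAction

variable {G : Type*} [Group G] {I : Type u} {A : Matrix I I ℕ}

theorem perm_ne_zero (a : PermutationAction G A) (g : G) {i j : I} (h : A i j ≠ 0) :
    A (a.perm g i) (a.perm g j) ≠ 0 := by
  obtain ⟨x, rfl, rfl⟩ := exists_point a.exists_follower a.exists_predecessor h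
  rw [← a.induced, ← a.induced]
  set y := (a.φ g).1 x with hy
  have h0 : (y.1 0).tgt = (y.1 1).src := by simpa using y.2 0
  rw [← h0]
  exact (lt_of_le_of_lt (Nat.zero_le _) (y.1 0).idx.2).ne'

/-- The permutations of the states preserve the matrix: `A(gi, gj) = A(i, j)`. -/
theorem perm_apply (a : PermutationAction G A) (g : G) (i j : I) :
    A (a.perm g i) (a.perm g j) = A i j := by
  have h1 := fun h => a.perm_ne_zero g (i := i) (j := j) h
  have h2 := fun h => a.perm_ne_zero g⁻¹ (i := a.perm g i) (j := a.perm g j) h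
  rw [← Equiv.Perm.mul_apply, ← Equiv.Perm.mul_apply, ← map_mul, inv_mul_cancel, map_one] at h2
  simp only [Equiv.Perm.one_apply] at h2
  have h3 := a.zero_one i j
  have h4 := a.zero_one (a.perm g i) (a.perm g j)
  omega

/-- Two states are equivalent if they lie in the same `G`-orbit. -/
def orbitSetoid (a : PermutationAction G A) : Setoid I where
  r i j := ∃ g, a.perm g i = j
  iseqv :=
    { refl := fun i => ⟨1, by simp⟩
      symm := by
        rintro i _ ⟨g, rfl⟩
        exact ⟨g⁻¹, by simp⟩
      trans := by
        rintro i _ _ ⟨g, rfl⟩ ⟨h, rfl⟩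
        exact ⟨h * g, by simp⟩ }

/-- The set of `G`-orbits of states. -/
abbrev Orbits (a : PermutationAction G A) : Type u := Quotient a.orbitSetoid

/-- The orbit `Gi` of the state `i`. -/
abbrev orb (a : PermutationAction G A) (i : I) : a.Orbits := Quotient.mk a.orbitSetoid i

theorem orb_perm (a : PermutationAction G A) (g : G) (i : I) : a.orb (a.perm g i) = a.orb i :=
  (Quotient.sound (s := a.orbitSetoid) ⟨g, rfl⟩ : a.orb i = a.orb (a.perm g i)).symm

open Classical in
/-- The matrix of the right-reduced shift, `A_φ(Gi, Gj) = ∑_{k ∈ Gj} A(i, k)`. -/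
noncomputable def rightReduced [Fintype I] (a : PermutationAction G A) :
    Matrix a.Orbits a.Orbits ℕ := fun p q =>
  Quotient.lift (s := a.orbitSetoid) (fun i => ∑ k with a.orb k = q, A i k) (by
    rintro i _ ⟨g, rfl⟩
    refine Finset.sum_equiv (a.perm g) (fun k => ?_) (fun k _ => (a.perm_apply g i k).symm)
    simp only [Finset.mem_filter_univ, a.orb_perm]) p

open Classical in
/-- The matrix of the left-reduced shift, `_φA(Gi, Gj) = ∑_{k ∈ Gi} A(k, j)`. -/
noncomputable def leftReduced [Fintype I] (a : PermutationAction G A) :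
    Matrix a.Orbits a.Orbits ℕ := fun p q =>
  Quotient.lift (s := a.orbitSetoid) (fun j => ∑ k with a.orb k = p, A k j) (by
    rintro j _ ⟨g, rfl⟩
    refine Finset.sum_equiv (a.perm g) (fun k => ?_) (fun k _ => (a.perm_apply g k j).symm)
    simp only [Finset.mem_filter_univ, a.orb_perm]) q

open Classical in
theorem rightReduced_orb [Fintype I] (a : PermutationAction G A) (i j : I) :
    a.rightReduced (a.orb i) (a.orb j) = ∑ k with a.orb k = a.orb j, A i k := rfl

open Classical in
theorem leftReduced_orb [Fintype I] (a : PermutationAction G A) (i j : I) :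
    a.leftReduced (a.orb i) (a.orb j) = ∑ k with a.orb k = a.orb i, A k j := rfl

end PermutationAction

end ReducedShift

namespace ReducedShift

/-! ### Conjugacy of the shifts of `R * S` and `S * R` -/

/-! Everything happens on the single space `SFT A`. Given an equivariant conjugacy `η`, let `P x` be
the state of `x` at time zero and `Q x` that of `η x`. Both are equivariant colorings, with
transition matrices `A` and `B`. Both are Markov, and by compactness each is a function of a finite
window of the other.

Hence `P` and `Q` can each be refined, one small step at a time, to the joint coloring by `P` and
`Q` on the times `0, …, 2N`. A step replaces a Markov coloring `f` by a refinement `h` that is a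
function of `f` at two consecutive times. The two transition matrices are then `R * S` and `S * R`
with equivariant `R` and `S` (`IsMarkov.elementarilyEquivalent`).

Summing over column orbits respects products of equivariant matrices (`reduce_mul`), so the reduced
matrices again have the form `R' * S'` and `S' * R'`, and their shifts are conjugate
(`conjugate_mul_comm`). Transposition gives the left-reduced case. -/

theorem Conjugate.refl {I : Type*} (A : Matrix I I ℕ) : Conjugate A A :=
  ⟨Homeomorph.refl _, fun _ => rfl⟩

theorem Conjugate.symm {I J : Type*} {A : Matrix I I ℕ} {B : Matrix J J ℕ}
    (h : Conjugate A B) : Conjugate B A := by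
  obtain ⟨η, hη⟩ := h
  refine ⟨η.symm, fun x => η.injective ?_⟩
  rw [hη, η.apply_symm_apply, η.apply_symm_apply]

theorem Conjugate.trans {I J K : Type*} {A : Matrix I I ℕ} {B : Matrix J J ℕ} {C : Matrix K K ℕ}
    (h : Conjugate A B) (h' : Conjugate B C) : Conjugate A C := by
  obtain ⟨η, hη⟩ := h
  obtain ⟨θ, hθ⟩ := h'
  exact ⟨η.trans θ, fun x => by simp [hη, hθ]⟩

/-- The edges of the bipartite graph with `R k l` parallel edges from `k` to `l`. -/
abbrev Arrow {K L : Type*} (R : Matrix K L ℕ) : Type _ := Σ k : K, Σ l : L, Fin (R k l)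

/-- Pairs of composable edges in two consecutive bipartite graphs. -/
abbrev ArrowPair {K L M : Type*} (R : Matrix K L ℕ) (S : Matrix L M ℕ) : Type _ :=
  {p : Arrow R × Arrow S // p.1.2.1 = p.2.1}

/-- The entry `(R * S) i j` counts two-step paths from `i` to `j`; any choice of bijections, one for
each `i` and `j`, will do. -/
theorem exists_edge_equiv_arrowPair {K L : Type*} [Fintype L]
    (R : Matrix K L ℕ) (S : Matrix L K ℕ) :
    ∃ θ : Edge (R * S) ≃ ArrowPair R S,
      ∀ e, (θ e).1.1.1 = e.src ∧ (θ e).1.2.2.1 = e.tgt := by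
  have h : ∀ i j, Nonempty (Fin ((R * S) i j) ≃ Σ l, Fin (R i l) × Fin (S l j)) := fun i j =>
    ⟨Fintype.equivOfCardEq (by rw [Fintype.card_fin]; simp [Matrix.mul_apply])⟩
  let e := fun i j => (h i j).some
  refine ⟨⟨fun a => ⟨(⟨a.src, (e _ _ a.idx).1, (e _ _ a.idx).2.1⟩,
      ⟨(e _ _ a.idx).1, a.tgt, (e _ _ a.idx).2.2⟩), rfl⟩,
    fun p => ⟨p.1.1.1, p.1.2.2.1, (e _ _).symm ⟨p.1.2.1, p.2 ▸ p.1.1.2.2, p.1.2.2.2⟩⟩, ?_, ?_⟩,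
    fun a => ⟨rfl, rfl⟩⟩
  · rintro ⟨i, j, a⟩
    simp
  · rintro ⟨⟨⟨i, l, r⟩, ⟨l', j, s⟩⟩, h⟩
    obtain rfl : l = l' := h
    have hq := (e i j).apply_symm_apply ⟨l, (r, s)⟩
    refine Subtype.ext ?_
    dsimp only
    -- The round-trip value occurs inside dependent types, so it is generalized before the equation
    -- is substituted.
    generalize e i j ((e i j).symm ⟨l, (r, s)⟩) = q at hq ⊢
    subst hq
    rfl

/-- A path for `R * S` is an alternating sequence of `R`- and `S`-arrows. Bracketing it the other
way, each `S`-arrow with the `R`-arrow after it, gives a path for `S * R`; the inverse therefore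
looks one step back. -/
theorem conjugate_mul_comm {K L : Type*} [Fintype K] [Fintype L]
    (R : Matrix K L ℕ) (S : Matrix L K ℕ) : Conjugate (R * S) (S * R) := by
  let : TopologicalSpace (Arrow R) := ⊥
  let : TopologicalSpace (Arrow S) := ⊥
  have : DiscreteTopology (Arrow R) := ⟨rfl⟩
  have : DiscreteTopology (Arrow S) := ⟨rfl⟩
  obtain ⟨θ, hθ⟩ := exists_edge_equiv_arrowPair R S
  obtain ⟨κ, hκ⟩ := exists_edge_equiv_arrowPair S R
  have hθ' : ∀ p, (θ.symm p).src = p.1.1.1 ∧ (θ.symm p).tgt = p.1.2.2.1 := fun p => by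
    have := hθ (θ.symm p)
    rw [θ.apply_symm_apply] at this
    exact ⟨this.1.symm, this.2.symm⟩
  have hκ' : ∀ p, (κ.symm p).src = p.1.1.1 ∧ (κ.symm p).tgt = p.1.2.2.1 := fun p => by
    have := hκ (κ.symm p)
    rw [κ.apply_symm_apply] at this
    exact ⟨this.1.symm, this.2.symm⟩
  have hx : ∀ (x : SFT (R * S)) (n : ℤ), (θ (x.1 n)).1.2.2.1 = (θ (x.1 (n + 1))).1.1.1 :=
    fun x n => by rw [(hθ _).1, (hθ _).2]; exact x.2 n
  have hy : ∀ (y : SFT (S * R)) (n : ℤ), (κ (y.1 (n - 1))).1.2.2.1 = (κ (y.1 n)).1.1.1 :=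
    fun y n => by
      rw [(hκ _).1, (hκ _).2]
      simpa using y.2 (n - 1)
  let F : SFT (R * S) → SFT (S * R) := fun x =>
    ⟨fun n => κ.symm ⟨((θ (x.1 n)).1.2, (θ (x.1 (n + 1))).1.1), hx x n⟩, fun n => by
      rw [(hκ' _).1, (hκ' _).2]
      exact (θ (x.1 (n + 1))).2⟩
  let H : SFT (S * R) → SFT (R * S) := fun y =>
    ⟨fun n => θ.symm ⟨((κ (y.1 (n - 1))).1.2, (κ (y.1 n)).1.1), hy y n⟩, fun n => by
      rw [(hθ' _).1, (hθ' _).2]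
      simpa using (κ (y.1 n)).2⟩
  have hF : Continuous F := by
    refine Continuous.subtype_mk (continuous_pi fun n => ?_) _
    refine (continuous_of_discreteTopology (f := κ.symm)).comp (Continuous.subtype_mk ?_ _)
    refine Continuous.prodMk ?_ ?_
    · exact (continuous_of_discreteTopology (f := fun e => (θ e).1.2)).comp
        ((continuous_apply n).comp continuous_subtype_val)
    · exact (continuous_of_discreteTopology (f := fun e => (θ e).1.1)).comp
        ((continuous_apply (n + 1)).comp continuous_subtype_val)
  have hH : Continuous H := by
    refine Continuous.subtype_mk (continuous_pi fun n => ?_) _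
    refine (continuous_of_discreteTopology (f := θ.symm)).comp (Continuous.subtype_mk ?_ _)
    refine Continuous.prodMk ?_ ?_
    · exact (continuous_of_discreteTopology (f := fun e => (κ e).1.2)).comp
        ((continuous_apply (n - 1)).comp continuous_subtype_val)
    · exact (continuous_of_discreteTopology (f := fun e => (κ e).1.1)).comp
        ((continuous_apply n).comp continuous_subtype_val)
  refine ⟨⟨⟨F, H, fun x => ?_, fun y => ?_⟩, hF, hH⟩, fun x => ?_⟩
  · ext1
    funext n
    simp [F, H]
  · ext1
    funext n
    simp [F, H]
  · ext1
    funext n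
    change (F (shiftHomeo _ x)).1 n = (shiftHomeo _ (F x)).1 n
    rw [shiftHomeo_apply]
    simp [F, shiftHomeo_apply]

end ReducedShift

namespace ReducedShift

/-! ### Reduction of equivariant matrices -/

section Reduce

variable {G : Type*} [Group G] {K L M : Type*}

/-- Two points are equivalent if they lie in the same orbit of the permutation action `ρ`. -/
def permSetoid (ρ : G →* Equiv.Perm K) : Setoid K where
  r i j := ∃ g, ρ g i = j
  iseqv :=
    { refl := fun i => ⟨1, by simp⟩
      symm := by
        rintro i _ ⟨g, rfl⟩
        exact ⟨g⁻¹, by simp⟩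
      trans := by
        rintro i _ _ ⟨g, rfl⟩ ⟨h, rfl⟩
        exact ⟨h * g, by simp⟩ }

theorem permSetoid_mk_perm (ρ : G →* Equiv.Perm K) (g : G) (k : K) :
    Quotient.mk (permSetoid ρ) (ρ g k) = Quotient.mk (permSetoid ρ) k :=
  (Quotient.sound (s := permSetoid ρ) ⟨g, rfl⟩ :
    Quotient.mk (permSetoid ρ) k = Quotient.mk (permSetoid ρ) (ρ g k)).symm

/-- A matrix is equivariant if simultaneous permutation of rows and columns preserves it. -/
def IsEquivariant (ρ : G →* Equiv.Perm K) (τ : G →* Equiv.Perm L) (A : Matrix K L ℕ) : Prop :=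
  ∀ g k l, A (ρ g k) (τ g l) = A k l

theorem IsEquivariant.transpose {ρ : G →* Equiv.Perm K} {τ : G →* Equiv.Perm L}
    {A : Matrix K L ℕ} (h : IsEquivariant ρ τ A) : IsEquivariant τ ρ A.transpose :=
  fun g l k => h g k l

open Classical in
/-- The matrix between orbits whose entries sum an equivariant matrix over the orbits of
columns. -/
noncomputable def reduce [Fintype L] (ρ : G →* Equiv.Perm K) (τ : G →* Equiv.Perm L)
    (A : Matrix K L ℕ) : Matrix (Quotient (permSetoid ρ)) (Quotient (permSetoid τ)) ℕ :=
  fun p q => ∑ l with Quotient.mk (permSetoid τ) l = q, A p.out l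

open Classical in
theorem reduce_mk [Fintype L] {ρ : G →* Equiv.Perm K} {τ : G →* Equiv.Perm L}
    {A : Matrix K L ℕ} (h : IsEquivariant ρ τ A) (k : K) (q : Quotient (permSetoid τ)) :
    reduce ρ τ A (Quotient.mk _ k) q = ∑ l with Quotient.mk (permSetoid τ) l = q, A k l := by
  obtain ⟨g, hg⟩ : ∃ g, ρ g k = (Quotient.mk (permSetoid ρ) k).out :=
    (permSetoid ρ).symm (Quotient.mk_out (s := permSetoid ρ) k)
  rw [reduce, ← hg]
  refine (Finset.sum_equiv (τ g) (fun l => ?_) (fun l _ => (h g k l).symm)).symm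
  simp only [Finset.mem_filter_univ, permSetoid_mk_perm]

/-- Group the sum over the middle index by orbits: equivariance of `B` makes its row sums over a
column orbit constant along each middle orbit, so they factor out. -/
theorem reduce_mul [Fintype L] [Fintype M] {ρ : G →* Equiv.Perm K} {τ : G →* Equiv.Perm L}
    {υ : G →* Equiv.Perm M} [Fintype (Quotient (permSetoid τ))]
    {A : Matrix K L ℕ} {B : Matrix L M ℕ}
    (hB : IsEquivariant τ υ B) :
    reduce ρ υ (A * B) = reduce ρ τ A * reduce τ υ B := by
  classical
  ext p q
  simp only [Matrix.mul_apply]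
  rw [reduce]
  simp only [Matrix.mul_apply]
  rw [Finset.sum_comm, ← Finset.sum_fiberwise _ (fun l => Quotient.mk (permSetoid τ) l)]
  refine Finset.sum_congr rfl fun r _ => ?_
  rw [reduce, Finset.sum_mul]
  refine Finset.sum_congr (by ext; simp) fun l hl => ?_
  rw [← (Finset.mem_filter.mp hl).2, reduce_mk hB, Finset.mul_sum]

/-- Equivariant elementary strong shift equivalence of two square matrices. -/
def ElementarilyEquivalent [Fintype K] [Fintype L] (ρ : G →* Equiv.Perm K)
    (τ : G →* Equiv.Perm L) (A : Matrix K K ℕ) (B : Matrix L L ℕ) : Prop :=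
  ∃ (R : Matrix K L ℕ) (S : Matrix L K ℕ), IsEquivariant ρ τ R ∧ IsEquivariant τ ρ S ∧
    A = R * S ∧ B = S * R

variable [Fintype K] [Fintype L] {ρ : G →* Equiv.Perm K} {τ : G →* Equiv.Perm L}
  {A : Matrix K K ℕ} {B : Matrix L L ℕ}

theorem ElementarilyEquivalent.transpose (h : ElementarilyEquivalent ρ τ A B) :
    ElementarilyEquivalent ρ τ A.transpose B.transpose := by
  obtain ⟨R, S, hR, hS, rfl, rfl⟩ := h
  exact ⟨S.transpose, R.transpose, hS.transpose, hR.transpose, Matrix.transpose_mul _ _,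
    Matrix.transpose_mul _ _⟩

theorem ElementarilyEquivalent.conjugate_reduce (h : ElementarilyEquivalent ρ τ A B) :
    Conjugate (reduce ρ ρ A) (reduce τ τ B) := by
  classical
  have := Fintype.ofFinite (Quotient (permSetoid ρ))
  have := Fintype.ofFinite (Quotient (permSetoid τ))
  obtain ⟨R, S, hR, hS, rfl, rfl⟩ := h
  rw [reduce_mul (τ := τ) hS, reduce_mul (τ := ρ) hR]
  exact conjugate_mul_comm _ _

theorem ElementarilyEquivalent.conjugate_reduce_transpose
    (h : ElementarilyEquivalent ρ τ A B) :
    Conjugate (reduce ρ ρ A.transpose).transpose (reduce τ τ B.transpose).transpose := by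
  classical
  have := Fintype.ofFinite (Quotient (permSetoid ρ))
  have := Fintype.ofFinite (Quotient (permSetoid τ))
  obtain ⟨R, S, hR, hS, rfl, rfl⟩ := h
  rw [Matrix.transpose_mul, Matrix.transpose_mul, reduce_mul (τ := τ) hR.transpose,
    reduce_mul (τ := ρ) hS.transpose, Matrix.transpose_mul, Matrix.transpose_mul]
  exact conjugate_mul_comm _ _

end Reduce

/-! ### Incidence matrices -/

section Incidence

variable {X K L M : Type*}

open Classical in
/-- The matrix whose `(k, l)` entry records whether `f` and `h` take the values `k` and `l`
simultaneously. -/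
noncomputable def incidence (f : X → K) (h : X → L) : Matrix K L ℕ :=
  fun k l => if ∃ x, f x = k ∧ h x = l then 1 else 0

theorem incidence_transpose (f : X → K) (h : X → L) :
    (incidence f h).transpose = incidence h f := by
  ext k l
  simp only [incidence, Matrix.transpose_apply]
  congr 1
  exact propext (exists_congr fun _ => and_comm)

theorem incidence_comp_equiv {Y : Type*} (f : X → K) (h : X → L) (e : Y ≃ X) :
    incidence (f ∘ e) (h ∘ e) = incidence f h := by
  ext k l
  simp only [incidence, Function.comp_apply]
  congr 1
  exact propext (e.exists_congr_left.trans (by simp))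

/-- An entry of the product counts the middle values compatible with both ends. By `glue` they are
all realized by a single point joining the ends, and by `det` there is at most one. -/
theorem incidence_mul_incidence [Fintype L] (f : X → K) (h : X → L) (k : X → M)
    (glue : ∀ x y, h x = h y → ∃ z, f z = f x ∧ h z = h x ∧ k z = k y)
    (det : ∀ x y, f x = f y → k x = k y → h x = h y) :
    incidence f h * incidence h k = incidence f k := by
  classical
  ext i j
  rw [Matrix.mul_apply]
  by_cases hz : ∃ z, f z = i ∧ k z = j
  · obtain ⟨z, rfl, rfl⟩ := hz
    rw [Finset.sum_eq_single (h z)]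
    · simp only [incidence]
      rw [if_pos ⟨z, rfl, rfl⟩, if_pos ⟨z, rfl, rfl⟩, if_pos ⟨z, rfl, rfl⟩]
    · intro l _ hl
      simp only [incidence]
      by_contra hne
      rw [← ne_eq, mul_ne_zero_iff, ite_ne_right_iff, ite_ne_right_iff] at hne
      obtain ⟨⟨⟨x, hx, rfl⟩, -⟩, ⟨y, hy, hy'⟩, -⟩ := hne
      obtain ⟨w, h1, h2, h3⟩ := glue x y hy.symm
      exact hl (h2 ▸ det w z (h1.trans hx) (h3.trans hy'))
    · simp
  · rw [incidence, if_neg hz]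
    refine Finset.sum_eq_zero fun l _ => ?_
    simp only [incidence]
    by_contra hne
    rw [← ne_eq, mul_ne_zero_iff, ite_ne_right_iff, ite_ne_right_iff] at hne
    obtain ⟨⟨⟨x, hx, rfl⟩, -⟩, ⟨y, hy, hy'⟩, -⟩ := hne
    obtain ⟨w, h1, -, h3⟩ := glue x y hy.symm
    exact hz ⟨w, h1.trans hx, h3.trans hy'⟩

theorem isEquivariant_incidence {G : Type*} [Group G] {α : G → X → X} {ρ : G →* Equiv.Perm K}
    {τ : G →* Equiv.Perm L} {f : X → K} {h : X → L} (hf : ∀ g x, f (α g x) = ρ g (f x))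
    (hh : ∀ g x, h (α g x) = τ g (h x)) : IsEquivariant ρ τ (incidence f h) := by
  intro g k l
  have key : ∀ g k l, (∃ x, f x = k ∧ h x = l) → ∃ x, f x = ρ g k ∧ h x = τ g l := by
    rintro g _ _ ⟨x, rfl, rfl⟩
    exact ⟨α g x, hf g x, hh g x⟩
  have key' := key g⁻¹ (ρ g k) (τ g l)
  simp only [← Equiv.Perm.mul_apply, ← map_mul, inv_mul_cancel, map_one,
    Equiv.Perm.one_apply] at key'
  simp only [incidence]
  congr 1
  exact propext ⟨key', key g k l⟩

end Incidence

/-! ### Markov colorings -/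

/-- A coloring is Markov if two orbits with the same color at time zero can be spliced: the past
of the first continues as the future of the second. -/
def IsMarkov {X K : Type*} (σ : Equiv.Perm X) (f : X → K) : Prop :=
  ∀ x y, f x = f y → ∃ z, (∀ n : ℤ, n ≤ 0 → f ((σ ^ n) z) = f ((σ ^ n) x)) ∧
    ∀ n : ℤ, 0 ≤ n → f ((σ ^ n) z) = f ((σ ^ n) y)

section Markov

variable {X K L : Type*} {σ : Equiv.Perm X} {f : X → K} {h : X → L}

theorem IsMarkov.inv (hf : IsMarkov σ f) : IsMarkov σ⁻¹ f := by
  intro x y hxy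
  obtain ⟨z, h1, h2⟩ := hf y x hxy.symm
  refine ⟨z, fun n hn => ?_, fun n hn => ?_⟩
  · rw [inv_zpow']
    exact h2 _ (by omega)
  · rw [inv_zpow']
    exact h1 _ (by omega)

theorem IsMarkov.comp_equiv {Y : Type*} {τ : Equiv.Perm Y} (hf : IsMarkov σ f) (e : Y ≃ X)
    (he : ∀ y, e (τ y) = σ (e y)) : IsMarkov τ (f ∘ e) := by
  have hn : ∀ (n : ℤ) (y : Y), e ((τ ^ n) y) = (σ ^ n) (e y) := by
    have : σ = (Equiv.permCongrHom e) τ := by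
      ext x
      simp [Equiv.permCongrHom, he]
    intro n y
    rw [this, ← map_zpow]
    simp [Equiv.permCongrHom]
  intro x y hxy
  obtain ⟨z, h1, h2⟩ := hf (e x) (e y) hxy
  refine ⟨e.symm z, fun n h => ?_, fun n h => ?_⟩
  · simpa [hn] using h1 n h
  · simpa [hn] using h2 n h

theorem IsMarkov.refine (hf : IsMarkov σ f) (hhf : ∀ x y, h x = h y → f x = f y)
    (hfh : ∀ x y, f x = f y → f (σ x) = f (σ y) → h x = h y) : IsMarkov σ h := by
  intro x y hxy
  obtain ⟨z, h1, h2⟩ := hf x y (hhf x y hxy)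
  have hs : ∀ (n : ℤ) w, σ ((σ ^ n) w) = (σ ^ (n + 1)) w := fun n w => by
    rw [add_comm, zpow_add, zpow_one, Equiv.Perm.mul_apply]
  have h3 : ∀ n : ℤ, 0 ≤ n → h ((σ ^ n) z) = h ((σ ^ n) y) := fun n hn =>
    hfh _ _ (h2 n hn) (by rw [hs, hs]; exact h2 _ (by omega))
  refine ⟨z, fun n hn => ?_, h3⟩
  rcases hn.eq_or_lt with rfl | hn
  -- At time zero the past half says nothing about `f` at time one, so the future half and `h x = h
  -- y` are used instead.
  · exact (h3 0 le_rfl).trans hxy.symm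
  · exact hfh _ _ (h1 n hn.le) (by rw [hs, hs]; exact h1 _ (by omega))

theorem IsMarkov.elementarilyEquivalent {G : Type*} [Group G] [Fintype K] [Fintype L]
    {α : G → X → X} {ρ : G →* Equiv.Perm K} {τ : G →* Equiv.Perm L} (hf : IsMarkov σ f)
    (hσ : ∀ g x, α g (σ x) = σ (α g x))
    (hρ : ∀ g x, f (α g x) = ρ g (f x)) (hτ : ∀ g x, h (α g x) = τ g (h x))
    (hhf : ∀ x y, h x = h y → f x = f y)
    (hfh : ∀ x y, f x = f y → f (σ x) = f (σ y) → h x = h y) :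
    ElementarilyEquivalent ρ τ (incidence f (f ∘ σ)) (incidence h (h ∘ σ)) := by
  have hρσ : ∀ g x, (f ∘ σ) (α g x) = ρ g ((f ∘ σ) x) := fun g x => by
    simp [← hσ, hρ]
  refine ⟨incidence f h, incidence h (f ∘ σ), isEquivariant_incidence hρ hτ,
    isEquivariant_incidence hτ hρσ, ?_, ?_⟩
  · exact (incidence_mul_incidence f h (f ∘ σ)
      (fun x y hxy => ⟨y, (hhf x y hxy).symm, hxy.symm, rfl⟩) hfh).symm
  -- Moving `R` forward by one time unit makes `f ∘ σ` the common middle coloring of `S` and `R`.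
  · rw [← incidence_comp_equiv f h σ]
    refine (incidence_mul_incidence h (f ∘ σ) (h ∘ σ) (fun x y hxy => ?_)
      (fun x y _ hxy => hhf _ _ hxy)).symm
    -- Splice at time one, then shift back: the colors at times 0 and 1 come from `x`, those at
    -- times 1 and 2 from `y`.
    obtain ⟨z, h1, h2⟩ := hf (σ x) (σ y) hxy
    have hz : f (σ (σ⁻¹ z)) = f (σ x) := by simpa using h1 0 le_rfl
    refine ⟨σ⁻¹ z, hfh _ _ (by simpa using h1 (-1) (by omega)) hz, hz, hfh _ _ ?_ ?_⟩
    · simpa using h2 0 le_rfl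
    · simpa using h2 1 (by omega)

end Markov

end ReducedShift

namespace ReducedShift

/-! ### Equivariant colorings and their reduced matrices -/

/-- A map to a finite set of colors that intertwines the maps `α g` with permutations of the
colors. -/
structure Coloring (G : Type*) [Group G] {X : Type*} (α : G → X → X) where
  /-- The colors. -/
  Color : Type u
  fintype : Fintype Color
  /-- The action of `G` on the colors. -/
  perm : G →* Equiv.Perm Color
  /-- The color of a point. -/
  toFun : X → Color
  map_act : ∀ g x, toFun (α g x) = perm g (toFun x)

namespace Coloring

attribute [instance] Coloring.fintype

variable {G X : Type*} [Group G] {α : G → X → X}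

/-- The transition matrix of a coloring: which colors can follow each other along `σ`. -/
noncomputable def transition (C : Coloring G α) (σ : Equiv.Perm X) :
    Matrix C.Color C.Color ℕ :=
  incidence C.toFun (C.toFun ∘ σ)

theorem transition_inv (C : Coloring G α) (σ : Equiv.Perm X) :
    C.transition σ⁻¹ = (C.transition σ).transpose := by
  rw [transition, transition, incidence_transpose, ← incidence_comp_equiv C.toFun _ σ]
  congr 1
  ext x
  simp

/-- The reduced shifts of two colorings are conjugate, on either side. -/
def Linked (σ : Equiv.Perm X) (C : Coloring.{u} G α) (D : Coloring.{v} G α) : Prop :=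
  Conjugate (reduce C.perm C.perm (C.transition σ)) (reduce D.perm D.perm (D.transition σ)) ∧
    Conjugate (reduce C.perm C.perm (C.transition σ).transpose).transpose
      (reduce D.perm D.perm (D.transition σ).transpose).transpose

variable {σ : Equiv.Perm X}

theorem Linked.symm {C : Coloring.{u} G α} {D : Coloring.{v} G α} (h : Linked σ C D) :
    Linked σ D C :=
  ⟨h.1.symm, h.2.symm⟩

theorem Linked.trans {C D E : Coloring G α} (h : Linked σ C D)
    (h' : Linked σ D E) : Linked σ C E :=
  ⟨h.1.trans h'.1, h.2.trans h'.2⟩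

theorem linked_of_isMarkov {C D : Coloring G α} (hσ : ∀ g x, α g (σ x) = σ (α g x))
    (hC : IsMarkov σ C.toFun) (hDC : ∀ x y, D.toFun x = D.toFun y → C.toFun x = C.toFun y)
    (hCD : ∀ x y, C.toFun x = C.toFun y → C.toFun (σ x) = C.toFun (σ y) →
      D.toFun x = D.toFun y) : Linked σ C D := by
  have h := hC.elementarilyEquivalent hσ C.map_act D.map_act hDC hCD
  exact ⟨h.conjugate_reduce, h.conjugate_reduce_transpose⟩

/-- Reversing time transposes the transition matrices, and elementary equivalence survives
transposition. -/
theorem linked_of_isMarkov_inv {C D : Coloring G α} (hσ : ∀ g x, α g (σ x) = σ (α g x))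
    (hC : IsMarkov σ C.toFun) (hDC : ∀ x y, D.toFun x = D.toFun y → C.toFun x = C.toFun y)
    (hCD : ∀ x y, C.toFun x = C.toFun y → C.toFun (σ⁻¹ x) = C.toFun (σ⁻¹ y) →
      D.toFun x = D.toFun y) : Linked σ C D := by
  have hσ' : ∀ g x, α g (σ⁻¹ x) = σ⁻¹ (α g x) := fun g x => by
    rw [Equiv.Perm.eq_inv_iff_eq, ← hσ]
    exact congrArg _ (σ.apply_symm_apply x)
  have h := (hC.inv.elementarilyEquivalent hσ' C.map_act D.map_act hDC hCD).transpose
  change ElementarilyEquivalent _ _ (C.transition σ⁻¹).transpose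
    (D.transition σ⁻¹).transpose at h
  rw [transition_inv, transition_inv, Matrix.transpose_transpose, Matrix.transpose_transpose] at h
  exact ⟨h.conjugate_reduce, h.conjugate_reduce_transpose⟩

/-! ### Windows of two colorings -/

/-- The action on tuples induced by a permutation action. -/
def permPi {K : Type*} (S : Type*) (ρ : G →* Equiv.Perm K) : G →* Equiv.Perm (S → K) where
  toFun g := Equiv.arrowCongr (Equiv.refl S) (ρ g)
  map_one' := by ext; simp
  map_mul' g h := by ext; simp

/-- The action on pairs induced by two permutation actions. -/
def permProd {K L : Type*} (ρ : G →* Equiv.Perm K) (τ : G →* Equiv.Perm L) :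
    G →* Equiv.Perm (K × L) where
  toFun g := Equiv.prodCongr (ρ g) (τ g)
  map_one' := by ext <;> simp
  map_mul' g h := by ext <;> simp

open Classical in
/-- The coloring that records the `P`-colors at the times in `S` and the `Q`-colors at the times
in `T`. -/
noncomputable def window (hσ : ∀ g x, α g (σ x) = σ (α g x)) (P : Coloring.{u} G α)
    (Q : Coloring.{v} G α) (S T : Finset ℤ) : Coloring.{max u v} G α where
  Color := (S → P.Color) × (T → Q.Color)
  fintype := inferInstance
  perm := permProd (permPi S P.perm) (permPi T Q.perm)
  toFun x := (fun s => P.toFun ((σ ^ s.1) x), fun t => Q.toFun ((σ ^ t.1) x))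
  map_act g x := by
    have h : ∀ n : ℤ, (σ ^ n) (α g x) = α g ((σ ^ n) x) := fun n => by
      induction n using Int.induction_on with
      | zero => simp
      | succ n ih => rw [add_comm, zpow_add, zpow_one, Equiv.Perm.mul_apply, ih, ← hσ,
          Equiv.Perm.mul_apply]
      | pred n ih =>
        rw [sub_eq_neg_add, zpow_add, zpow_neg_one, Equiv.Perm.mul_apply, ih,
          Equiv.Perm.inv_eq_iff_eq, ← hσ, Equiv.Perm.mul_apply]
        exact congrArg (α g) (σ.apply_symm_apply _).symm
    simp only [h, P.map_act, Q.map_act]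
    rfl

variable (hσ : ∀ g x, α g (σ x) = σ (α g x)) (P : Coloring.{u} G α) (Q : Coloring.{v} G α)

theorem window_eq_iff (S T : Finset ℤ) (x y : X) :
    (window hσ P Q S T).toFun x = (window hσ P Q S T).toFun y ↔
      (∀ n ∈ S, P.toFun ((σ ^ n) x) = P.toFun ((σ ^ n) y)) ∧
        ∀ n ∈ T, Q.toFun ((σ ^ n) x) = Q.toFun ((σ ^ n) y) := by
  simp [window, funext_iff]

/-- The two windows carry the same information, so this is a trivial refinement. -/
theorem linked_window_swap (S T : Finset ℤ) (h : IsMarkov σ (window hσ P Q S T).toFun) :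
    Linked σ (window hσ P Q S T) (window hσ Q P T S) := by
  refine linked_of_isMarkov hσ h (fun x y hxy => ?_) (fun x y hxy _ => ?_) <;>
  · rw [window_eq_iff] at hxy ⊢
    exact hxy.symm

/-- If `P` is Markov and determines `Q` through a window of radius `N`, then it is linked to the
joint window of `P` and `Q` of length `2 N`. -/
theorem isMarkov_and_linked_window (hP : IsMarkov σ P.toFun) (N : ℕ)
    (hN : ∀ x y, (∀ n ∈ Finset.Icc (-N : ℤ) N, P.toFun ((σ ^ n) x) = P.toFun ((σ ^ n) y)) →
      Q.toFun x = Q.toFun y) :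
    IsMarkov σ (window hσ P Q (Finset.Icc 0 (2 * N)) (Finset.Icc 0 (2 * N))).toFun ∧
      Linked σ P (window hσ P Q (Finset.Icc 0 (2 * N)) (Finset.Icc 0 (2 * N))) := by
  -- The Markov property is carried along because the next refinement needs it.
  let Reach : Finset ℤ → Finset ℤ → Prop := fun S T =>
    IsMarkov σ (window hσ P Q S T).toFun ∧ Linked σ P (window hσ P Q S T)
  have hadd : ∀ (m n : ℤ) (x : X), (σ ^ m) ((σ ^ n) x) = (σ ^ (m + n)) x := fun m n x => by
    rw [zpow_add, Equiv.Perm.mul_apply]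
  have hs : ∀ (n : ℤ) (x : X), (σ ^ n) (σ x) = (σ ^ (n + 1)) x := fun n x => by
    rw [zpow_add, zpow_one, Equiv.Perm.mul_apply]
  have hs' : ∀ (n : ℤ) (x : X), (σ ^ n) (σ⁻¹ x) = (σ ^ (n - 1)) x := fun n x => by
    rw [sub_eq_add_neg, zpow_add, zpow_neg_one, Equiv.Perm.mul_apply]
  have forward : ∀ {S T S' T'}, Reach S T → S ⊆ S' → T ⊆ T' →
      (∀ x y, (∀ n ∈ S, P.toFun ((σ ^ n) x) = P.toFun ((σ ^ n) y)) →
        (∀ n ∈ T, Q.toFun ((σ ^ n) x) = Q.toFun ((σ ^ n) y)) →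
        (∀ n ∈ S, P.toFun ((σ ^ (n + 1)) x) = P.toFun ((σ ^ (n + 1)) y)) →
        (∀ n ∈ T, Q.toFun ((σ ^ (n + 1)) x) = Q.toFun ((σ ^ (n + 1)) y)) →
        (∀ n ∈ S', P.toFun ((σ ^ n) x) = P.toFun ((σ ^ n) y)) ∧
        ∀ n ∈ T', Q.toFun ((σ ^ n) x) = Q.toFun ((σ ^ n) y)) → Reach S' T' := by
    intro S T S' T' hST hS hT h
    have h1 : ∀ x y, (window hσ P Q S' T').toFun x = (window hσ P Q S' T').toFun y →
        (window hσ P Q S T).toFun x = (window hσ P Q S T).toFun y := fun x y hxy => by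
      rw [window_eq_iff] at hxy ⊢
      exact ⟨fun n hn => hxy.1 n (hS hn), fun n hn => hxy.2 n (hT hn)⟩
    have h2 : ∀ x y, (window hσ P Q S T).toFun x = (window hσ P Q S T).toFun y →
        (window hσ P Q S T).toFun (σ x) = (window hσ P Q S T).toFun (σ y) →
        (window hσ P Q S' T').toFun x = (window hσ P Q S' T').toFun y := fun x y h3 h4 => by
      rw [window_eq_iff] at h3 h4 ⊢
      simp only [hs] at h4
      exact h x y h3.1 h3.2 h4.1 h4.2
    exact ⟨hST.1.refine h1 h2, hST.2.trans (linked_of_isMarkov hσ hST.1 h1 h2)⟩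
  have backward : ∀ {S T S' T'}, Reach S T → S ⊆ S' → T ⊆ T' →
      (∀ x y, (∀ n ∈ S, P.toFun ((σ ^ n) x) = P.toFun ((σ ^ n) y)) →
        (∀ n ∈ T, Q.toFun ((σ ^ n) x) = Q.toFun ((σ ^ n) y)) →
        (∀ n ∈ S, P.toFun ((σ ^ (n - 1)) x) = P.toFun ((σ ^ (n - 1)) y)) →
        (∀ n ∈ T, Q.toFun ((σ ^ (n - 1)) x) = Q.toFun ((σ ^ (n - 1)) y)) →
        (∀ n ∈ S', P.toFun ((σ ^ n) x) = P.toFun ((σ ^ n) y)) ∧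
        ∀ n ∈ T', Q.toFun ((σ ^ n) x) = Q.toFun ((σ ^ n) y)) → Reach S' T' := by
    intro S T S' T' hST hS hT h
    have h1 : ∀ x y, (window hσ P Q S' T').toFun x = (window hσ P Q S' T').toFun y →
        (window hσ P Q S T).toFun x = (window hσ P Q S T).toFun y := fun x y hxy => by
      rw [window_eq_iff] at hxy ⊢
      exact ⟨fun n hn => hxy.1 n (hS hn), fun n hn => hxy.2 n (hT hn)⟩
    have h2 : ∀ x y, (window hσ P Q S T).toFun x = (window hσ P Q S T).toFun y →
        (window hσ P Q S T).toFun (σ⁻¹ x) = (window hσ P Q S T).toFun (σ⁻¹ y) →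
        (window hσ P Q S' T').toFun x = (window hσ P Q S' T').toFun y := fun x y h3 h4 => by
      rw [window_eq_iff] at h3 h4 ⊢
      simp only [hs'] at h4
      exact h x y h3.1 h3.2 h4.1 h4.2
    exact ⟨by simpa using (hST.1.inv.refine h1 h2).inv,
      hST.2.trans (linked_of_isMarkov_inv hσ hST.1 h1 h2)⟩
  have hbase : Reach (Finset.Icc 0 0) ∅ := by
    have h1 : ∀ x y, (window hσ P Q (Finset.Icc 0 0) ∅).toFun x =
        (window hσ P Q (Finset.Icc 0 0) ∅).toFun y ↔ P.toFun x = P.toFun y := fun x y => by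
      rw [window_eq_iff]
      simp
    exact ⟨hP.refine (fun x y => (h1 x y).1) (fun x y h _ => (h1 x y).2 h),
      linked_of_isMarkov hσ hP (fun x y => (h1 x y).1) (fun x y h _ => (h1 x y).2 h)⟩
  have hfirst : ∀ m : ℕ, Reach (Finset.Icc 0 m) ∅ := by
    intro m
    induction m with
    | zero => exact_mod_cast hbase
    | succ m ih =>
      refine forward ih (Finset.Icc_subset_Icc le_rfl (by simp)) subset_rfl
        (fun x y h1 _ h2 _ => ⟨fun n hn => ?_, by simp⟩)
      rw [Finset.mem_Icc] at hn
      rcases hn.1.eq_or_lt with rfl | h0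
      · exact h1 0 (by simp)
      · have := h2 (n - 1) (by rw [Finset.mem_Icc]; push_cast at hn; omega)
        rwa [sub_add_cancel] at this
  -- The interval of radius `N` about time `N` is exactly `[0, 2N]`, so the `P`-window already
  -- determines `Q` at time `N`.
  have hmid : Reach (Finset.Icc 0 (2 * N)) (Finset.Icc N N) := by
    have h := hfirst (2 * N)
    push_cast at h
    refine forward h subset_rfl (Finset.empty_subset _) fun x y h1 _ _ _ => ⟨h1, fun n hn => ?_⟩
    obtain rfl : n = N := by simpa using hn
    refine hN _ _ fun k hk => ?_
    rw [hadd, hadd]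
    refine h1 _ ?_
    rw [Finset.mem_Icc] at hk ⊢
    omega
  have hright : ∀ m : ℕ, Reach (Finset.Icc 0 (2 * N)) (Finset.Icc N (N + m)) := by
    intro m
    induction m with
    | zero => simpa using hmid
    | succ m ih =>
      refine forward ih subset_rfl (Finset.Icc_subset_Icc le_rfl (by simp))
        (fun x y h0 h1 _ h2 => ⟨h0, fun n hn => ?_⟩)
      rw [Finset.mem_Icc] at hn
      rcases hn.1.eq_or_lt with rfl | h0
      · exact h1 N (by simp)
      · have := h2 (n - 1) (by rw [Finset.mem_Icc]; push_cast at hn; omega)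
        rwa [sub_add_cancel] at this
  -- Now the `Q`-window grows into the past, one time at a time, until it fills `[0, 2N]`.
  have hleft : ∀ m : ℕ, Reach (Finset.Icc 0 (2 * N)) (Finset.Icc (N - m) (2 * N)) := by
    intro m
    induction m with
    | zero =>
      have := hright N
      rw [← two_mul] at this
      simpa using this
    | succ m ih =>
      refine backward ih subset_rfl (Finset.Icc_subset_Icc (by push_cast; omega) le_rfl)
        (fun x y h0 h1 _ h2 => ⟨h0, fun n hn => ?_⟩)
      rw [Finset.mem_Icc] at hn
      rcases hn.2.eq_or_lt with rfl | h0
      · exact h1 _ (by rw [Finset.mem_Icc]; omega)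
      · have := h2 (n + 1) (by rw [Finset.mem_Icc]; push_cast at hn; omega)
        rwa [add_sub_cancel_right] at this
  have := hleft N
  rwa [sub_self] at this

/-- Two Markov colorings that determine each other through finite windows are linked. -/
theorem linked_of_determined (hσ : ∀ g x, α g (σ x) = σ (α g x)) (P : Coloring.{u} G α)
    (Q : Coloring.{v} G α) (hP : IsMarkov σ P.toFun) (hQ : IsMarkov σ Q.toFun)
    (hPQ : ∃ N : ℕ, ∀ x y, (∀ n ∈ Finset.Icc (-N : ℤ) N,
      P.toFun ((σ ^ n) x) = P.toFun ((σ ^ n) y)) → Q.toFun x = Q.toFun y)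
    (hQP : ∃ N : ℕ, ∀ x y, (∀ n ∈ Finset.Icc (-N : ℤ) N,
      Q.toFun ((σ ^ n) x) = Q.toFun ((σ ^ n) y)) → P.toFun x = P.toFun y) :
    Linked σ P Q := by
  obtain ⟨N, hN⟩ := hPQ
  obtain ⟨M, hM⟩ := hQP
  have mono : ∀ {m n : ℕ}, m ≤ n → Finset.Icc (-m : ℤ) m ⊆ Finset.Icc (-n : ℤ) n := fun h =>
    Finset.Icc_subset_Icc (by omega) (by omega)
  -- A common radius makes the two joint windows agree up to order.
  obtain ⟨h1, h2⟩ := isMarkov_and_linked_window hσ P Q hP (max N M)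
    (fun x y h => hN x y fun n hn => h n (mono (le_max_left _ _) hn))
  obtain ⟨-, h3⟩ := isMarkov_and_linked_window hσ Q P hQ (max N M)
    (fun x y h => hM x y fun n hn => h n (mono (le_max_right _ _) hn))
  exact (h2.trans (linked_window_swap hσ P Q _ _ h1)).trans h3.symm

end Coloring

end ReducedShift

namespace ReducedShift

/-! ### Locally constant maps are determined by finite windows -/

/-- Compactness: if no window sufficed, the pairs that agree on the `N`-th window but differ under
`h` would form decreasing nonempty closed sets, and a common point would contradict `gen`. -/
theorem exists_window_of_isLocallyConstant {X I J : Type*} [TopologicalSpace X] [CompactSpace X]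
    (σ : Equiv.Perm X) {f : X → I} {h : X → J}
    (hf : ∀ n : ℤ, IsLocallyConstant fun x => f ((σ ^ n) x)) (hh : IsLocallyConstant h)
    (gen : ∀ x y, (∀ n : ℤ, f ((σ ^ n) x) = f ((σ ^ n) y)) → h x = h y) :
    ∃ N : ℕ, ∀ x y, (∀ n ∈ Finset.Icc (-N : ℤ) N, f ((σ ^ n) x) = f ((σ ^ n) y)) →
      h x = h y := by
  by_contra! hN
  let E : ℤ → Set (X × X) := fun n => {p | f ((σ ^ n) p.1) = f ((σ ^ n) p.2)}
  have hE : ∀ n, IsClosed (E n) := fun n => by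
    have := (((hf n).comp_continuous continuous_fst).prodMk
      ((hf n).comp_continuous continuous_snd)) {p : I × I | p.1 ≠ p.2}
    rw [← isOpen_compl_iff]
    exact this
  have hD : IsClosed {p : X × X | h p.1 ≠ h p.2} := by
    have := ((hh.comp_continuous continuous_fst).prodMk
      (hh.comp_continuous continuous_snd)) {p : J × J | p.1 = p.2}
    rw [← isOpen_compl_iff]
    convert this using 1
    ext p
    simp
  let C : ℕ → Set (X × X) := fun N =>
    (⋂ n ∈ Finset.Icc (-N : ℤ) N, E n) ∩ {p : X × X | h p.1 ≠ h p.2}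
  have hC : ∀ N, IsClosed (C N) := fun N =>
    (isClosed_iInter fun n => isClosed_iInter fun _ => hE n).inter hD
  obtain ⟨p, hp⟩ := IsCompact.nonempty_iInter_of_sequence_nonempty_isCompact_isClosed C
    (fun N => Set.inter_subset_inter_left _ (Set.biInter_subset_biInter_left
      (Finset.Icc_subset_Icc (by push_cast; omega) (by push_cast; omega))))
    (fun N => by
      obtain ⟨x, y, h1, h2⟩ := hN N
      exact ⟨(x, y), Set.mem_iInter₂.mpr h1, h2⟩)
    (hC 0).isCompact hC
  rw [Set.mem_iInter] at hp
  refine (hp 0).2 (gen _ _ fun n => ?_)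
  exact Set.mem_iInter₂.mp (hp n.natAbs).1 n (by rw [Finset.mem_Icc]; omega)

/-! ### The state coloring of a permutation action -/

instance {I : Type*} [Finite I] (A : Matrix I I ℕ) : CompactSpace (SFT A) :=
  isCompact_iff_compactSpace.mp (sft A).isClosed.isCompact

/-- The state visited at time zero. -/
def state {I : Type*} (A : Matrix I I ℕ) (x : SFT A) : I := (x.1 0).src

section State

variable {I : Type*} {A : Matrix I I ℕ}

theorem shiftHomeo_zpow_apply (n : ℤ) (x : SFT A) (k : ℤ) :
    (((shiftHomeo A).toEquiv ^ n : Equiv.Perm (SFT A)) x).1 k = x.1 (k + n) := by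
  induction n using Int.induction_on generalizing x k with
  | zero => simp
  | succ n ih =>
    rw [zpow_add, zpow_one, Equiv.Perm.mul_apply, ih]
    exact (shiftHomeo_apply A x _).trans (by rw [add_assoc])
  | pred n ih =>
    rw [sub_eq_add_neg, zpow_add, zpow_neg_one, Equiv.Perm.mul_apply, ih]
    obtain ⟨y, rfl⟩ := (shiftHomeo A).surjective x
    rw [shiftHomeo_apply]
    have : ((shiftHomeo A).toEquiv⁻¹ : Equiv.Perm (SFT A)) (shiftHomeo A y) = y :=
      (shiftHomeo A).toEquiv.symm_apply_apply y
    rw [this]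
    exact congrArg y.1 (by ring)

theorem state_zpow (n : ℤ) (x : SFT A) :
    state A (((shiftHomeo A).toEquiv ^ n : Equiv.Perm (SFT A)) x) = (x.1 n).src := by
  rw [state, shiftHomeo_zpow_apply, zero_add]

/-- Two paths through the same state at time zero can be cut and joined there. -/
theorem isMarkov_state : IsMarkov (shiftHomeo A).toEquiv (state A) := by
  intro x y hxy
  refine ⟨⟨fun n => if n < 0 then x.1 n else y.1 n, fun n => ?_⟩, fun n hn => ?_, fun n hn => ?_⟩
  · dsimp only
    split_ifs with h1 h2 h2
    · exact x.2 n
    · obtain rfl : n = -1 := by omega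
      exact (x.2 (-1)).trans hxy
    · omega
    · exact y.2 n
  · rw [state_zpow, state_zpow]
    dsimp only
    split_ifs with h
    · rfl
    · obtain rfl : n = 0 := by omega
      exact hxy.symm
  · rw [state_zpow, state_zpow]
    dsimp only
    rw [if_neg (by omega)]

theorem isLocallyConstant_src (n : ℤ) : IsLocallyConstant fun x : SFT A => (x.1 n).src :=
  (IsLocallyConstant.of_discrete fun e : Edge A => e.src).comp_continuous
    (f := fun x : SFT A => x.1 n) ((continuous_apply n).comp continuous_subtype_val)

theorem eq_of_src_eq (hA : ∀ i j, A i j = 0 ∨ A i j = 1) {x y : SFT A}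
    (h : ∀ n, (x.1 n).src = (y.1 n).src) : x = y := by
  have hedge : ∀ e e' : Edge A, e.src = e'.src → e.tgt = e'.tgt → e = e' := by
    rintro ⟨i, j, r⟩ ⟨_, _, s⟩ rfl rfl
    have : r = s := by
      ext
      have := hA i j
      omega
    rw [this]
  ext1
  funext n
  exact hedge _ _ (h n) (by rw [x.2 n, y.2 n, h])

/-- Every edge lies on a bi-infinite path, so an allowed transition is realized by a point of the
shift. -/
theorem incidence_state (hA : ∀ i j, A i j = 0 ∨ A i j = 1)
    (hf : ∀ i, ∃ j, A i j ≠ 0) (hp : ∀ j, ∃ i, A i j ≠ 0) :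
    incidence (state A) (state A ∘ (shiftHomeo A).toEquiv) = A := by
  have hs : ∀ x : SFT A, state A ((shiftHomeo A).toEquiv x) = (x.1 1).src := fun x => by
    simpa using state_zpow 1 x
  ext i j
  simp only [incidence, Function.comp_apply, hs]
  split_ifs with h
  · obtain ⟨x, rfl, rfl⟩ := h
    have h0 : (x.1 0).tgt = (x.1 1).src := x.2 0
    have h1 : 0 < A (x.1 0).src (x.1 0).tgt := (Nat.zero_le _).trans_lt (x.1 0).idx.2
    rw [h0] at h1
    have := hA (x.1 0).src (x.1 1).src
    change 1 = A (x.1 0).src (x.1 1).src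
    omega
  · by_contra hne
    exact h (exists_point hf hp (Ne.symm hne))

end State

namespace PermutationAction

variable {G : Type*} [Group G] {I : Type*} [Fintype I] {A : Matrix I I ℕ}

/-- The coloring by the state at time zero, transported to a conjugate system. -/
def stateColoring (a : PermutationAction G A) {X : Type*} {α : G → X → X} (e : X ≃ SFT A)
    (he : ∀ g x, e (α g x) = (a.φ g).1 (e x)) : Coloring G α where
  Color := I
  fintype := inferInstance
  perm := a.perm
  toFun := state A ∘ e
  map_act g x := by
    simp only [Function.comp_apply, he]
    exact a.induced g (e x) 0

theorem transition_stateColoring (a : PermutationAction G A) {X : Type*} {α : G → X → X}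
    {σ : Equiv.Perm X} (e : X ≃ SFT A) (he : ∀ g x, e (α g x) = (a.φ g).1 (e x))
    (hσ : ∀ x, e (σ x) = shiftHomeo A (e x)) : (a.stateColoring e he).transition σ = A := by
  have h : (state A ∘ e) ∘ σ = (state A ∘ (shiftHomeo A).toEquiv) ∘ e := by
    ext x
    exact congrArg (state A) (hσ x)
  change incidence (state A ∘ e) ((state A ∘ e) ∘ σ) = A
  rw [h, incidence_comp_equiv, incidence_state a.zero_one a.exists_follower a.exists_predecessor]

theorem reduce_eq_rightReduced (a : PermutationAction G A) :
    reduce a.perm a.perm A = a.rightReduced := by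
  ext p q
  obtain ⟨i, rfl⟩ := Quotient.exists_rep p
  exact reduce_mk a.perm_apply i q

theorem reduce_eq_leftReduced (a : PermutationAction G A) :
    (reduce a.perm a.perm A.transpose).transpose = a.leftReduced := by
  ext p q
  obtain ⟨j, rfl⟩ := Quotient.exists_rep q
  have h : IsEquivariant a.perm a.perm A := a.perm_apply
  exact reduce_mk h.transpose j p

end PermutationAction

end ReducedShift

open ReducedShift in
/-- If two permutation actions of a finite group on shifts of finite type are conjugate, then
their right-reduced shifts are conjugate, and so are their left-reduced shifts. -/
theorem theorem3p6 {G : Type*} [Group G] [Finite G] {I J : Type*} [Fintype I] [Fintype J]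
    {A : Matrix I I ℕ} {B : Matrix J J ℕ}
    (a : ReducedShift.PermutationAction G A) (b : ReducedShift.PermutationAction G B)
    (h : ReducedShift.ActionConjugate a.φ b.φ) :
    ReducedShift.Conjugate a.rightReduced b.rightReduced ∧
      ReducedShift.Conjugate a.leftReduced b.leftReduced := by
  obtain ⟨η, hη, hg⟩ := h
  let σ : Equiv.Perm (SFT A) := (shiftHomeo A).toEquiv
  let α : G → SFT A → SFT A := fun g x => (a.φ g).1 x
  let P : Coloring G α := a.stateColoring (Equiv.refl _) (fun _ _ => rfl)
  -- Equivariance of `η` is exactly what makes the pulled-back state map a coloring for the same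
  -- action.
  let Q : Coloring G α := b.stateColoring η.toEquiv hg
  have hσ : ∀ (g : G) (x : SFT A), α g (σ x) = σ (α g x) := fun g x =>
    congrArg (fun f : SFT A ≃ₜ SFT A => f x)
      (Subgroup.mem_centralizer_singleton_iff.mp (a.φ g).2)
  have hPn : ∀ (n : ℤ) (x : SFT A), P.toFun ((σ ^ n) x) = (x.1 n).src := state_zpow
  have hηn : ∀ (n : ℤ) (x : SFT A),
      η ((σ ^ n) x) = ((shiftHomeo B).toEquiv ^ n : Equiv.Perm (SFT B)) (η x) := by
    have : (shiftHomeo B).toEquiv = η.toEquiv.permCongrHom σ := by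
      ext1 y
      obtain ⟨x, rfl⟩ := η.surjective y
      simpa [Equiv.permCongrHom, σ] using (hη x).symm
    intro n x
    rw [this, ← map_zpow]
    simp [Equiv.permCongrHom]
  have hQn : ∀ (n : ℤ) (x : SFT A), Q.toFun ((σ ^ n) x) = ((η x).1 n).src := fun n x => by
    change state B (η ((σ ^ n) x)) = _
    rw [hηn, state_zpow]
  have hPl : ∀ n : ℤ, IsLocallyConstant fun x => P.toFun ((σ ^ n) x) := fun n => by
    simp only [hPn]
    exact isLocallyConstant_src n
  have hQl : ∀ n : ℤ, IsLocallyConstant fun x => Q.toFun ((σ ^ n) x) := fun n => by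
    simp only [hQn]
    exact (isLocallyConstant_src n).comp_continuous η.continuous
  have hL : P.Linked σ Q := by
    refine Coloring.linked_of_determined hσ P Q isMarkov_state
      (isMarkov_state.comp_equiv η.toEquiv hη)
      (exists_window_of_isLocallyConstant σ hPl (hQl 0) fun x y hxy => ?_)
      (exists_window_of_isLocallyConstant σ hQl (hPl 0) fun x y hxy => ?_)
    · simp only [hPn] at hxy
      rw [eq_of_src_eq a.zero_one hxy]
    · simp only [hQn] at hxy
      rw [η.injective (eq_of_src_eq b.zero_one hxy)]
  have hPt : P.transition σ = A := a.transition_stateColoring (Equiv.refl _) _ fun _ => rfl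
  have hQt : Q.transition σ = B := b.transition_stateColoring η.toEquiv _ hη
  obtain ⟨hR, hL⟩ := hL
  rw [hPt, hQt] at hR hL
  rw [← a.reduce_eq_rightReduced, ← b.reduce_eq_rightReduced, ← a.reduce_eq_leftReduced,
    ← b.reduce_eq_leftReduced]
  exact ⟨hR, hL⟩
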